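/- Let $g\ge 0$ and let $\mathbb{R}^{2g}$ have basis $p_1,\dots,p_g,q_1,\dots,q_g$ and symplectic form $\omega$ with $\omega(p_i,p_j)=\omega(q_i,q_j)=0$, $\omega(p_i,q_j)=-\omega(q_j,p_i)=\delta_{ij}$. Let $Sp(g,\mathbb{R})$ be its group of linear isometries and $\lambda_0=\mathrm{span}(p_1,\dots,p_g)$. For $f,f_1,f_2\in Sp(g,\mathbb{R})$ define the following. (a) $\star_f$ is the bilinear form $a\star_f b=\omega((f-1)^{-1}a,b)$ on $(f-1)\mathbb{R}^{2g}$ (any preimage of $a$ may be used); $\star_{f,\lambda_0}$ is its (symmetric) restriction to $\lambda_0\cap(f-1)\mathbb{R}^{2g}$; and $\star_{f_1,f_2}$ is the symmetric form $x\star_{f_1,f_2}y=\omega((f_1-1)^{-1}x+(f_2-1)^{-1}x+x,\,y)$ on $(f_1-1)\mathbb{R}^{2g}\cap(f_2-1)\mathbb{R}^{2g}$. (b) For Lagrangians $\lambda_1,\lambda_2,\lambda_3$, the Maslov index $\mu(\lambda_1,\lambda_2,\lambda_3)$ is the signature of the symmetric form $B(a,b)=\omega(x,b)$ on $(\lambda_1+\lambda_2)\cap\lambda_3$,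 where $x\in\lambda_2$ and $a-x\in\lambda_1$. (c) $n(f)=\mathrm{Signature}(\star_{f,\lambda_0})-\dim\big((f-1)\mathbb{R}^{2g}\big)-\mathrm{sgn}(\det\star_f)+1$, where $\det\star_f$ is the determinant of a matrix of $\star_f$ (equal to $1$ if $f=1$). (d) For oriented Lagrangians $\lambda_1,\lambda_2$ with $\kappa=\lambda_1\cap\lambda_2$, choose an ordered basis of $\kappa$ and extend it to ordered bases $(a_i)$ of $\lambda_1$ and $(b_i)$ of $\lambda_2$, whose first $\dim\kappa$ vectors are the given ones. Then $\epsilon(\lambda_1,\lambda_2)\in\{\pm1\}$ is the sign of $\det(\omega(a_i,b_j))_{i,j>\dim\kappa}$ (an empty determinant being $1$), multiplied by $-1$ for each of the bases $(a_i)$, $(b_i)$ that is not positively oriented. Put $s(f)=i^{\,g-\dim(\lambda_0\cap f(\lambda_0))}\,\epsilon(\lambda_0,f(\lambda_0))$, where $\lambda_0$ has an arbitrary orientation and $f(\lambda_0)$ has its image under $f$. Proposition. Suppose that for all $f_1,f_2\in Sp(g,\mathbb{R})$ $$\mathrm{Signature}(\star_{f_1,f_2})-\mu\big(\lambda_0,f_1(\lambda_0),f_1f_2(\lambda_0)\big)+\mathrm{Signature}(\star_{f_1f_2,\lambda_0})-\mathrm{Signature}(\star_{f_1,\lambda_0})-\mathrm{Signature}(\star_{f_2,\lambda_0})\equiv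 0\pmod 4.$$ Then $s(f)=i^{-n(f)}$ for all $f\in Sp(g,\mathbb{R})$ and every orientation of $\lambda_0$. -/

import Mathlib

noncomputable section

namespace SympSign

/-! ### Signatures and linear choices of preimages -/

/-- The signature (positive index minus negative index) of a symmetric bilinear form `B`
on a finite-dimensional real vector space. -/
def signature {M : Type*} [AddCommGroup M] [Module ℝ M] (B : LinearMap.BilinForm ℝ M) : ℤ :=
  (sigPos B.toQuadraticMap : ℤ) - (sigNeg B.toQuadraticMap : ℤ)

theorem exists_preimage {A B : Type*} [AddCommGroup A] [Module ℝ A] [AddCommGroup B] [Module ℝ B]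
    (h : A →ₗ[ℝ] B) : ∃ s : B →ₗ[ℝ] A, ∀ b ∈ LinearMap.range h, h (s b) = b := by
  obtain ⟨t, ht⟩ := h.rangeRestrict.exists_rightInverse_of_surjective h.range_rangeRestrict
  obtain ⟨s, hs⟩ := LinearMap.exists_extend t
  refine ⟨s, fun b hb => ?_⟩
  have h1 : s b = t ⟨b, hb⟩ := congrArg (fun φ => φ ⟨b, hb⟩) hs
  have h2 := congrArg (fun φ => ((φ ⟨b, hb⟩ : LinearMap.range h) : B)) ht
  rw [h1]
  simpa using h2

/-- A linear choice of a preimage under `h` of each element of the range of `h`.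
The forms below do not depend on this choice: see `starForm_apply`, `starPairForm_apply` and
`maslovForm_apply`. -/
def preimage {A B : Type*} [AddCommGroup A] [Module ℝ A] [AddCommGroup B] [Module ℝ B]
    (h : A →ₗ[ℝ] B) : B →ₗ[ℝ] A :=
  (exists_preimage h).choose

theorem apply_preimage {A B : Type*} [AddCommGroup A] [Module ℝ A] [AddCommGroup B] [Module ℝ B]
    (h : A →ₗ[ℝ] B) {b : B} (hb : b ∈ LinearMap.range h) : h (preimage h b) = b :=
  (exists_preimage h).choose_spec b hb

section General

variable {V : Type*} [AddCommGroup V] [Module ℝ V] (ω : LinearMap.BilinForm ℝ V)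

/-! ### The Lion-Vergne sign of a pair of oriented Lagrangians -/

/-- The sign (`1` or `-1`) of an ordered basis with respect to an orientation. -/
def basisSign {M : Type*} [AddCommGroup M] [Module ℝ M] {n : ℕ}
    (o : Orientation ℝ M (Fin n)) (b : Module.Basis (Fin n) ℝ M) : ℤ :=
  open Classical in if b.orientation = o then 1 else -1

/-- `a` and `b` are ordered bases of `lam₁` and `lam₂` which begin with one and the same ordered
basis of `κ = lam₁ ⊓ lam₂` (the first `dim κ` vectors of `a` and of `b` agree, hence lie in `κ`,
and being `dim κ` linearly independent vectors they form a basis of `κ`).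
The remaining vectors are lifts of ordered bases of `lam₁ / κ` and `lam₂ / κ`. -/
def IsAdapted {lam₁ lam₂ : Submodule ℝ V} {n : ℕ}
    (a : Module.Basis (Fin n) ℝ lam₁) (b : Module.Basis (Fin n) ℝ lam₂) : Prop :=
  ∀ i : Fin n, (i : ℕ) < Module.finrank ℝ ↥(lam₁ ⊓ lam₂) → (a i : V) = (b i : V)

/-- For adapted bases `a`, `b`: the matrix of the pairing induced by `ω` between `lam₁ / κ` and
`lam₂ / κ`, with respect to the classes of the last `n - dim κ` vectors of `a` and of `b`. -/
def quotientPairing {lam₁ lam₂ : Submodule ℝ V} {n : ℕ}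
    (a : Module.Basis (Fin n) ℝ lam₁) (b : Module.Basis (Fin n) ℝ lam₂) :
    Matrix {i : Fin n // Module.finrank ℝ ↥(lam₁ ⊓ lam₂) ≤ i}
      {i : Fin n // Module.finrank ℝ ↥(lam₁ ⊓ lam₂) ≤ i} ℝ :=
  Matrix.of fun i j => ω (a i.1 : V) (b j.1 : V)

/-- `ε(lam₁, lam₂)` for Lagrangians `lam₁`, `lam₂` with orientations `o₁`, `o₂`: the sign of
`det (ω(aᵢ, bⱼ))` for ordered bases of `lam₁ / κ` and `lam₂ / κ` that are positive for the
orientations induced by `o₁`, `o₂` and a common orientation of `κ = lam₁ ⊓ lam₂`.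
For bases that are not positive the determinant is corrected by the signs of the bases; this
also covers `κ = lam₁ = lam₂`, where the determinant is empty, equal to `1`, and `ε` compares
the two orientations. The product below is the same for all adapted `a`, `b`. -/
def epsilon {lam₁ lam₂ : Submodule ℝ V} {n : ℕ}
    (o₁ : Orientation ℝ lam₁ (Fin n)) (o₂ : Orientation ℝ lam₂ (Fin n)) : ℤ :=
  open Classical in
  if ∃ (a : Module.Basis (Fin n) ℝ lam₁) (b : Module.Basis (Fin n) ℝ lam₂), IsAdapted a b ∧
      basisSign o₁ a * basisSign o₂ b * (SignType.sign (quotientPairing ω a b).det : ℤ) = 1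
  then 1 else -1

/-- `s(lam₁, lam₂) = i ^ (dim lam₁ - dim (lam₁ ⊓ lam₂)) * ε(lam₁, lam₂)`. -/
def lagrangianS {lam₁ lam₂ : Submodule ℝ V} {n : ℕ}
    (o₁ : Orientation ℝ lam₁ (Fin n)) (o₂ : Orientation ℝ lam₂ (Fin n)) : ℂ :=
  Complex.I ^ (Module.finrank ℝ lam₁ - Module.finrank ℝ ↥(lam₁ ⊓ lam₂)) * (epsilon ω o₁ o₂ : ℂ)

/-! ### Turaev's forms, the Gilmer-Masbaum invariant and the Maslov index -/

/-- The image `(f - 1)V`. -/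
abbrev im (f : V →ₗ[ℝ] V) : Submodule ℝ V := LinearMap.range (f - 1)

/-- The form `a ⋆_f b = ω((f - 1)⁻¹ a, b)` on `(f - 1)V`. -/
def starForm (f : V →ₗ[ℝ] V) : LinearMap.BilinForm ℝ (im f) :=
  (ω.compLeft (preimage (f - 1))).restrict (im f)

/-- The restriction `⋆_{f, lam}` of `⋆_f` to `lam ∩ (f - 1)V`. -/
def starFormOn (f : V →ₗ[ℝ] V) (lam : Submodule ℝ V) :
    LinearMap.BilinForm ℝ (lam.comap (im f).subtype) :=
  (starForm ω f).restrict (lam.comap (im f).subtype)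

/-- The form `x ⋆_{f₁, f₂} y = ω((f₁ - 1)⁻¹ x + (f₂ - 1)⁻¹ x + x, y)` on
`(f₁ - 1)V ∩ (f₂ - 1)V`. -/
def starPairForm (f₁ f₂ : V →ₗ[ℝ] V) : LinearMap.BilinForm ℝ ↥(im f₁ ⊓ im f₂) :=
  (ω.compLeft (preimage (f₁ - 1) + preimage (f₂ - 1) + LinearMap.id)).restrict (im f₁ ⊓ im f₂)

/-- The sign of the determinant of a matrix of `⋆_f`. -/
def sgnDetStar (f : V →ₗ[ℝ] V) [FiniteDimensional ℝ V] : ℤ :=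
  (SignType.sign
    (LinearMap.BilinForm.toMatrix (Module.finBasis ℝ (im f)) (starForm ω f)).det : ℤ)

/-- `Signature(⋆_{f, lam})`. -/
def sigStarOn (lam : Submodule ℝ V) (f : V →ₗ[ℝ] V) : ℤ :=
  signature (starFormOn ω f lam)

/-- `Signature(⋆_{f₁, f₂})`. -/
def sigStarPairOf (f₁ f₂ : V →ₗ[ℝ] V) : ℤ :=
  signature (starPairForm ω f₁ f₂)

/-- `n_lam(f) = Signature(⋆_{f, lam}) - dim (f - 1)V - sgn(det ⋆_f) + 1`. -/
def gmN [FiniteDimensional ℝ V] (lam : Submodule ℝ V) (f : V →ₗ[ℝ] V) : ℤ :=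
  sigStarOn ω lam f - (Module.finrank ℝ (im f) : ℤ) - sgnDetStar ω f + 1

/-- The form `B(a, b) = ω(x, b)` on `(lam₁ + lam₂) ∩ lam₃`, where `x ∈ lam₂` and
`a - x ∈ lam₁`. -/
def maslovForm (lam₁ lam₂ lam₃ : Submodule ℝ V) :
    LinearMap.BilinForm ℝ ↥((lam₁ ⊔ lam₂) ⊓ lam₃) :=
  (ω.compLeft (lam₂.subtype ∘ₗ LinearMap.snd ℝ lam₁ lam₂ ∘ₗ
    preimage (lam₁.subtype.coprod lam₂.subtype))).restrict ((lam₁ ⊔ lam₂) ⊓ lam₃)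

/-- The Maslov index `μ(lam₁, lam₂, lam₃)`. -/
def maslov (lam₁ lam₂ lam₃ : Submodule ℝ V) : ℤ :=
  signature (maslovForm ω lam₁ lam₂ lam₃)

/-! The defining formulas, for every choice of preimages. -/

variable {ω}

theorem eq_of_sub_one_eq {f : V →ₗ[ℝ] V} (hf : ∀ x y, ω (f x) (f y) = ω x y) {x x' b : V}
    (h : (f - 1) x = (f - 1) x') (hb : b ∈ im f) : ω x b = ω x' b := by
  obtain ⟨z, rfl⟩ := hb
  have h0 : f (x - x') = x - x' := by
    have : (f - 1) (x - x') = 0 := by rw [map_sub, h, sub_self]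
    simpa [sub_eq_zero] using this
  have h1 : ω (x - x') ((f - 1) z) = 0 := by
    have := hf (x - x') z
    rw [h0] at this
    simp only [LinearMap.sub_apply, Module.End.one_apply, map_sub] at this ⊢
    linarith
  rw [map_sub, LinearMap.sub_apply] at h1
  linarith

theorem starForm_apply {f : V →ₗ[ℝ] V} (hf : ∀ x y, ω (f x) (f y) = ω x y) (a b : im f) (x : V)
    (hx : (f - 1) x = a) : starForm ω f a b = ω x b :=
  eq_of_sub_one_eq hf ((apply_preimage _ a.2).trans hx.symm) b.2

theorem starPairForm_apply {f₁ f₂ : V →ₗ[ℝ] V} (hf₁ : ∀ x y, ω (f₁ x) (f₁ y) = ω x y)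
    (hf₂ : ∀ x y, ω (f₂ x) (f₂ y) = ω x y) (a b : ↥(im f₁ ⊓ im f₂)) (x₁ x₂ : V)
    (hx₁ : (f₁ - 1) x₁ = a) (hx₂ : (f₂ - 1) x₂ = a) :
    starPairForm ω f₁ f₂ a b = ω (x₁ + x₂ + a) b := by
  have h1 := eq_of_sub_one_eq hf₁ ((apply_preimage _ a.2.1).trans hx₁.symm) b.2.1
  have h2 := eq_of_sub_one_eq hf₂ ((apply_preimage _ a.2.2).trans hx₂.symm) b.2.2
  change ω (preimage (f₁ - 1) (a : V) + preimage (f₂ - 1) (a : V) + (a : V)) (b : V) = _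
  simp only [map_add, LinearMap.add_apply, h1, h2]

theorem maslovForm_apply {lam₁ lam₂ lam₃ : Submodule ℝ V}
    (h₁ : ∀ x ∈ lam₁, ∀ y ∈ lam₁, ω x y = 0) (h₂ : ∀ x ∈ lam₂, ∀ y ∈ lam₂, ω x y = 0)
    (a b : ↥((lam₁ ⊔ lam₂) ⊓ lam₃)) (x : V) (hx : x ∈ lam₂) (hax : (a : V) - x ∈ lam₁) :
    maslovForm ω lam₁ lam₂ lam₃ a b = ω x b := by
  set p := preimage (lam₁.subtype.coprod lam₂.subtype) (a : V) with hp
  have hpa : (p.1 : V) + (p.2 : V) = a := by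
    have : (a : V) ∈ LinearMap.range (lam₁.subtype.coprod lam₂.subtype) := by
      rw [← Submodule.sup_eq_range]; exact a.2.1
    simpa using apply_preimage _ this
  change ω (p.2 : V) b = _
  have hd₂ : (p.2 : V) - x ∈ lam₂ := lam₂.sub_mem p.2.2 hx
  have hd₁ : (p.2 : V) - x ∈ lam₁ := by
    have : (p.2 : V) - x = (a - x) - p.1 := by rw [← hpa]; abel
    rw [this]; exact lam₁.sub_mem hax p.1.2
  obtain ⟨u, hu, v, hv, huv⟩ := Submodule.mem_sup.1 b.2.1
  have : ω ((p.2 : V) - x) b = 0 := by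
    rw [← huv, map_add, h₁ _ hd₁ _ hu, h₂ _ hd₂ _ hv, add_zero]
  rw [map_sub, LinearMap.sub_apply] at this
  linarith

end General

/-! ### The standard symplectic space and its symplectic group -/

/-- The space `ℝ^{2g}`; the basis vectors `p_i` and `q_i` are the standard vectors with indices
`Sum.inl i` and `Sum.inr i`. -/
abbrev Std (g : ℕ) : Type := Fin g ⊕ Fin g → ℝ

/-- The standard symplectic form, with `ω(p_i, q_j) = δ_ij = -ω(q_j, p_i)`. -/
def stdForm (g : ℕ) : LinearMap.BilinForm ℝ (Std g) :=
  Matrix.toBilin' (Matrix.fromBlocks 0 1 (-1) 0)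

theorem stdForm_apply (g : ℕ) (x y : Std g) :
    stdForm g x y = ∑ i, (x (Sum.inl i) * y (Sum.inr i) - x (Sum.inr i) * y (Sum.inl i)) := by
  simp [stdForm, Matrix.toBilin'_apply', Matrix.fromBlocks_mulVec, dotProduct,
    Matrix.neg_mulVec, Finset.sum_sub_distrib, ← sub_eq_add_neg]

/-- The Lagrangian spanned by the `p_i`. -/
def lambda0 (g : ℕ) : Submodule ℝ (Std g) :=
  Submodule.span ℝ (Set.range fun i : Fin g => (Pi.single (Sum.inl i) 1 : Std g))

/-- The real symplectic group `Sp(g, ℝ)` of `2g × 2g` matrices. -/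
abbrev Sp (g : ℕ) : Type := Matrix.symplecticGroup (Fin g) ℝ

/-- The linear automorphism of `ℝ^{2g}` given by a symplectic matrix. -/
def act {g : ℕ} (f : Sp g) : Std g ≃ₗ[ℝ] Std g :=
  LinearEquiv.ofLinearMap (Matrix.toLin' f.1) (Matrix.toLin' (f⁻¹).1)
    (by rw [← Matrix.toLin'_mul, ← Submonoid.coe_mul, mul_inv_cancel, Submonoid.coe_one,
      Matrix.toLin'_one])
    (by rw [← Matrix.toLin'_mul, ← Submonoid.coe_mul, inv_mul_cancel, Submonoid.coe_one,
      Matrix.toLin'_one])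

theorem act_apply {g : ℕ} (f : Sp g) (x : Std g) : act f x = f.1.mulVec x := rfl

/-- The symplectic matrices are exactly the matrices of isometries of the standard form. -/
theorem mem_symplecticGroup_iff {g : ℕ} (A : Matrix (Fin g ⊕ Fin g) (Fin g ⊕ Fin g) ℝ) :
    A ∈ Matrix.symplecticGroup (Fin g) ℝ ↔
      ∀ x y, stdForm g (A.mulVec x) (A.mulVec y) = stdForm g x y := by
  have hJ : (Matrix.fromBlocks 0 1 (-1) 0 : Matrix (Fin g ⊕ Fin g) (Fin g ⊕ Fin g) ℝ)
      = -Matrix.J (Fin g) ℝ := by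
    simp [Matrix.J, Matrix.fromBlocks_neg]
  have h : stdForm g = Matrix.toBilin' (-Matrix.J (Fin g) ℝ) := by rw [stdForm, hJ]
  have key : (∀ x y, stdForm g (A.mulVec x) (A.mulVec y) = stdForm g x y) ↔
      (stdForm g).comp (Matrix.toLin' A) (Matrix.toLin' A) = stdForm g := by
    constructor
    · intro H
      exact LinearMap.ext fun x => LinearMap.ext fun y => by simpa using H x y
    · intro H x y
      simpa using congrArg (fun B : LinearMap.BilinForm ℝ (Std g) => B x y) H
  rw [key, h, Matrix.toBilin'_comp, Matrix.toBilin'.injective.eq_iff, SymplecticGroup.mem_iff']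
  simp

theorem stdForm_act {g : ℕ} (f : Sp g) (x y : Std g) :
    stdForm g (act f x) (act f y) = stdForm g x y :=
  (mem_symplecticGroup_iff f.1).1 f.2 x y

/-- The subspace `f(lambda0)`. -/
abbrev image0 {g : ℕ} (f : Sp g) : Submodule ℝ (Std g) :=
  (lambda0 g).map (act f : Std g →ₗ[ℝ] Std g)

/-- The Lion-Vergne invariant `s(f) = s(lambda0, f(lambda0))`, computed with an orientation `o`
of `lambda0` and its image under `f` on `f(lambda0)`. -/
def lionVergneS {g : ℕ} (o : Orientation ℝ (lambda0 g) (Fin g)) (f : Sp g) : ℂ :=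
  lagrangianS (stdForm g) (lam₁ := lambda0 g) (lam₂ := image0 f)
    o (Orientation.map (Fin g) ((act f).submoduleMap (lambda0 g)) o)

/-- The Gilmer-Masbaum invariant `n(f)`, taken with respect to `lambda0`. -/
def gilmerMasbaumN {g : ℕ} (f : Sp g) : ℤ :=
  gmN (stdForm g) (lambda0 g) (act f : Std g →ₗ[ℝ] Std g)

/-- `Signature(⋆_{f, lambda0})` for `f` in `Sp(g, ℝ)`. -/
def sigStar {g : ℕ} (f : Sp g) : ℤ :=
  sigStarOn (stdForm g) (lambda0 g) (act f : Std g →ₗ[ℝ] Std g)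

/-- `Signature(⋆_{f₁, f₂})` for `f₁`, `f₂` in `Sp(g, ℝ)`. -/
def sigStarPair {g : ℕ} (f₁ f₂ : Sp g) : ℤ :=
  sigStarPairOf (stdForm g) (act f₁ : Std g →ₗ[ℝ] Std g) (act f₂ : Std g →ₗ[ℝ] Std g)

end SympSign

end

noncomputable section

namespace SympSign

open Module Matrix

/-! Both sides are computed from one pair of bases of $\lambda=\lambda_0$ adapted to $f$. Put
$m=\dim(\lambda\cap\ker(f-1))$, let $\rho$ be the dimension of the radical of $\star_{f,\lambda}$,
and let $(pos,neg)$ be its inertia. Since $(\lambda\cap(f-1)V)^\perp=\lambda+\ker(f-1)$, the radical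
is $(f-1)(\lambda\cap f^{-1}\lambda)$ (`map_ker_starFormOn`). Hence $\dim(\lambda\cap
f\lambda)=m+\rho$, and with $e=g-m-\rho$ a dimension count gives $\dim(f-1)V=2\rho+e+pos+neg$.

Choose bases $x,y$ of $\lambda$ that share $m$ vectors spanning $\lambda\cap\ker(f-1)$, satisfy
$x_i=f(y_i)$ for the next $\rho$ indices, and are arbitrary in the last $e$ places
(`exists_adapted_bases`). Then $x$ and $f(y)$ are adapted bases of $\lambda$ and $f(\lambda)$, so
$\epsilon=\mathrm{sgn}\det T\cdot\mathrm{sgn}\det E$, where $T$ is the transition matrix from $x$ to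
$y$ and $E_{ij}=\omega(x_i,f(y_j))$ on the last $e$ indices (`epsilon_map_eq`).

The same $E$ and $T$ occur in a Gram matrix of $\star_f$: the radical of $\star_{f,\lambda}$
contributes a hyperbolic block of determinant $(-1)^\rho$, and the nondegenerate part of
$\star_{f,\lambda}$ contributes the sign $(-1)^{neg}$ (`sgnDetStar_eq`). Thus
$\mathrm{sgn}\det\star_f=(-1)^{\rho+neg}\epsilon$. Finally
$-n(f)=e+2(\rho+neg)+(\mathrm{sgn}\det\star_f-1)$, so
$i^{-n(f)}=i^e(-1)^{\rho+neg}\,\mathrm{sgn}\det\star_f=i^e\epsilon=s(f)$ (`lagrangianS_map_eq`). -/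

/-! ### Determinants, basis signs and diagonalisation of forms. -/

theorem det_fromBlocks_hyperbolic {R ι κ : Type*} [CommRing R] [Fintype ι] [DecidableEq ι]
    [Fintype κ] [DecidableEq κ] (z : Matrix ι ι R) (b : Matrix ι κ R) (c : Matrix κ ι R)
    (D : Matrix κ κ R) :
    (fromBlocks (fromBlocks (0 : Matrix ι ι R) 1 1 z) (fromRows (0 : Matrix ι κ R) b) (fromCols (0 : Matrix κ ι R) c) D).det
      = (-1) ^ Fintype.card ι * D.det := by
  -- The first block column is $(0,1,0)^T$, so subtracting its multiples clears $b$ and changes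
  -- nothing else.
  have h : fromBlocks (fromBlocks (0 : Matrix ι ι R) 1 1 z) (fromRows (0 : Matrix ι κ R) b) (fromCols (0 : Matrix κ ι R) c) D
      * fromBlocks 1 (fromRows (-b) (0 : Matrix ι κ R)) 0 (1 : Matrix κ κ R) = fromBlocks (fromBlocks (0 : Matrix ι ι R) 1 1 z) 0 (fromCols (0 : Matrix κ ι R) c) D := by
    rw [fromBlocks_multiply]
    congr 1
    · simp
    · rw [fromBlocks_mul_fromRows]
      ext i j
      rcases i with i | i <;> simp
    · simp
    · rw [fromCols_mul_fromRows]
      simp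
  have h1 : (fromBlocks (0 : Matrix ι ι R) 1 1 z).det = (-1) ^ Fintype.card ι := by
    have h2 : fromBlocks (0 : Matrix ι ι R) 1 1 z * fromBlocks 1 0 1 1
        = fromBlocks 1 1 (1 + z) z := by
      rw [fromBlocks_multiply]; simp
    have h3 := congrArg Matrix.det h2
    rw [det_mul, det_fromBlocks_zero₁₂, det_fromBlocks_one₁₁] at h3
    simpa [det_neg] using h3
  have h4 := congrArg Matrix.det h
  rw [det_mul, det_fromBlocks_zero₁₂, det_fromBlocks_zero₂₁, h1] at h4
  simpa using h4

theorem basisSign_mul_basisSign {M : Type*} [AddCommGroup M] [Module ℝ M] {n : ℕ}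
    (o : Orientation ℝ M (Fin n)) (a b : Basis (Fin n) ℝ M) :
    basisSign o a * basisSign o b = (SignType.sign (a.toMatrix b).det : ℤ) := by
  rw [← Basis.det_apply]
  have hne : a.det b ≠ 0 := (a.isUnit_det b).ne_zero
  have h := Basis.orientation_eq_iff_det_pos a b
  unfold basisSign
  by_cases hab : a.orientation = b.orientation
  · rw [sign_pos (h.1 hab), hab]
    split_ifs <;> simp
  · have : a.det b < 0 := lt_of_le_of_ne (not_lt.1 fun h' => hab (h.2 h')) hne
    rw [sign_neg this]
    by_cases ha : a.orientation = o
    · have hb : b.orientation ≠ o := fun hb => hab (ha.trans hb.symm)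
      simp [ha, hb]
    · have h1 := (a.orientation_eq_or_eq_neg o).resolve_left (Ne.symm ha)
      by_cases hb : b.orientation = o
      · simp [ha, hb]
      · have h2 := (b.orientation_eq_or_eq_neg o).resolve_left (Ne.symm hb)
        exact absurd (neg_injective (h1.symm.trans h2)) hab

theorem basisSign_mul_self {M : Type*} [AddCommGroup M] [Module ℝ M] {n : ℕ}
    (o : Orientation ℝ M (Fin n)) (a : Basis (Fin n) ℝ M) :
    basisSign o a * basisSign o a = 1 := by
  simp [basisSign_mul_basisSign]

theorem basisSign_map {M N : Type*} [AddCommGroup M] [Module ℝ M] [AddCommGroup N] [Module ℝ N]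
    {n : ℕ} (o : Orientation ℝ M (Fin n)) (a : Basis (Fin n) ℝ M) (f : M ≃ₗ[ℝ] N) :
    basisSign (Orientation.map (Fin n) f o) (a.map f) = basisSign o a := by
  have h : (a.map f).orientation = Orientation.map (Fin n) f a.orientation := a.orientation_map f
  unfold basisSign
  have h2 := (Orientation.map (Fin n) f).injective.eq_iff (a := a.orientation) (b := o)
  rw [← h] at h2
  classical exact if_congr h2 rfl rfl

/-- A change of basis multiplies the determinant by a square. Allowing two index types makes the
block-indexed basis of `sgnDetStar_eq` comparable with `Module.finBasis`. -/
theorem sign_det_toMatrix_eq {M ι ι' : Type*} [AddCommGroup M] [Module ℝ M]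
    [Fintype ι] [DecidableEq ι] [Fintype ι'] [DecidableEq ι']
    (B : LinearMap.BilinForm ℝ M) (b : Basis ι ℝ M) (c : Basis ι' ℝ M) :
    SignType.sign (LinearMap.BilinForm.toMatrix b B).det
      = SignType.sign (LinearMap.BilinForm.toMatrix c B).det := by
  have key : ∀ d : Basis ι ℝ M, SignType.sign (LinearMap.BilinForm.toMatrix b B).det
      = SignType.sign (LinearMap.BilinForm.toMatrix d B).det := by
    intro d
    rw [← LinearMap.BilinForm.toMatrix_mul_basis_toMatrix b d B, det_mul, det_mul, det_transpose,
      mul_right_comm, sign_mul]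
    have : 0 < (b.toMatrix d).det * (b.toMatrix d).det := by
      rw [← Basis.det_apply]; exact mul_self_pos.2 (b.isUnit_det d).ne_zero
    rw [sign_pos this, one_mul]
  rw [key (c.reindex (c.indexEquiv b))]
  congr 1
  have : LinearMap.BilinForm.toMatrix (c.reindex (c.indexEquiv b)) B
      = (LinearMap.BilinForm.toMatrix c B).submatrix (c.indexEquiv b).symm
        (c.indexEquiv b).symm := by
    ext i j; simp [LinearMap.BilinForm.toMatrix_apply]
  rw [this, det_submatrix_equiv_self]

theorem exists_basis_extending {W ι : Type*} [AddCommGroup W] [Module ℝ W] [FiniteDimensional ℝ W]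
    [Fintype ι] {v : ι → W} (hv : LinearIndependent ℝ v) {e : ℕ}
    (he : Fintype.card ι + e = finrank ℝ W) :
    ∃ b : Basis (ι ⊕ Fin e) ℝ W, ∀ i, b (Sum.inl i) = v i := by
  let b := Basis.sumExtend hv
  have hfin : Finite (ι ⊕ Basis.sumExtendIndex hv) := Module.Finite.finite_basis b
  have hfin' : Finite (Basis.sumExtendIndex hv) := Finite.sum_right ι
  have := Fintype.ofFinite (Basis.sumExtendIndex hv)
  have hc : Fintype.card (Basis.sumExtendIndex hv) = e := by
    have := finrank_eq_card_basis b
    rw [Fintype.card_sum] at this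
    omega
  refine ⟨b.reindex (Equiv.sumCongr (Equiv.refl ι) (Fintype.equivFinOfCardEq hc)), fun i => ?_⟩
  simp [b, Basis.sumExtend]
  rfl

theorem exists_biorthogonal {W ι : Type*} [AddCommGroup W] [Module ℝ W] [FiniteDimensional ℝ W]
    [Fintype ι] [DecidableEq ι] {B : LinearMap.BilinForm ℝ W} (hB : B.Nondegenerate) {v : ι → W}
    (hv : LinearIndependent ℝ v) : ∃ z : ι → W, ∀ i j, B (v i) (z j) = if i = j then 1 else 0 := by
  obtain ⟨e, he⟩ : ∃ e, Fintype.card ι + e = finrank ℝ W :=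
    ⟨_, Nat.add_sub_of_le hv.fintype_card_le_finrank⟩
  obtain ⟨b, hb⟩ := exists_basis_extending hv he
  -- The flip puts the dual vectors in the right-hand slot; this matters because $\star_f$ is not
  -- symmetric.
  refine ⟨fun j => B.flip.dualBasis hB.flip b (Sum.inl j), fun i j => ?_⟩
  have := LinearMap.BilinForm.apply_dualBasis_left (B := B.flip) hB.flip b (Sum.inl j) (Sum.inl i)
  rw [hb, LinearMap.BilinForm.flip_apply] at this
  rw [this]
  simp [Sum.inl.injEq]

theorem sign_prod_eq_neg_one_pow {ι : Type*} [Fintype ι] (w : ι → ℝ) (hw : ∀ i, w i ≠ 0) :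
    SignType.sign (∏ i, w i) = (-1) ^ (Finset.univ.filter fun i => w i < 0).card := by
  have h : SignType.sign (∏ i, w i) = ∏ i, SignType.sign (w i) :=
    map_prod (signHom : ℝ →*₀ SignType) w Finset.univ
  have h2 : ∀ i, SignType.sign (w i) = if w i < 0 then -1 else 1 := fun i => by
    split_ifs with hi
    · exact sign_neg hi
    · exact sign_pos (lt_of_le_of_ne (not_lt.1 hi) (hw i).symm)
  rw [h, Finset.prod_congr rfl fun i _ => h2 i, Finset.prod_ite]
  simp

/-- Sylvester's law of inertia: in a diagonalising basis `pos` and `neg` count the diagonal entries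
of each sign. The vectors with nonzero entry give the nondegenerate part of the form, the others the
radical. -/
theorem exists_orthogonal_basis_signature {W : Type*} [AddCommGroup W] [Module ℝ W]
    [FiniteDimensional ℝ W] {B : LinearMap.BilinForm ℝ W} (hB : ∀ x y, B x y = B y x) :
    ∃ (v : Basis (Fin (finrank ℝ W)) ℝ W) (pos neg : ℕ), (∀ i j, i ≠ j → B (v i) (v j) = 0) ∧
      signature B = (pos : ℤ) - neg ∧ Nat.card {i // B (v i) (v i) ≠ 0} = pos + neg ∧
      SignType.sign (∏ i : {i // B (v i) (v i) ≠ 0}, B (v i) (v i)) = (-1) ^ neg ∧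
      pos + neg + finrank ℝ (LinearMap.ker B) = finrank ℝ W := by
  have hS : LinearMap.IsSymm B := LinearMap.BilinForm.isSymm_iff.1 ⟨hB⟩
  have hass : QuadraticMap.associated (R := ℝ) B.toQuadraticMap = B :=
    QuadraticMap.associated_left_inverse ℝ hB
  obtain ⟨v, hv⟩ := LinearMap.BilinForm.exists_orthogonal_basis hS
  have hequiv : B.toQuadraticMap.Equivalent
      (QuadraticMap.weightedSumSquares ℝ fun i => B (v i) (v i)) := by
    have := QuadraticMap.basisRepr_eq_of_iIsOrtho B.toQuadraticMap v (by rwa [hass])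
    refine ⟨(B.toQuadraticMap.isometryEquivBasisRepr v).trans ?_⟩
    rw [this]
    exact QuadraticMap.IsometryEquiv.refl _
  have h1 := QuadraticForm.sigPos_of_equiv_weightedSumSquares hequiv
  have h2 := QuadraticForm.sigNeg_of_equiv_weightedSumSquares hequiv
  have h3 := QuadraticForm.sigPos_add_sigNeg_add_radical (Q := B.toQuadraticMap)
  rw [QuadraticMap.radical_eq_ker_associated, hass] at h3
  refine ⟨v, _, _, fun i j hij => hv hij, rfl, ?_, ?_, h3⟩
  · rw [h1, h2, ← Set.ncard_union_eq (by
      rw [Set.disjoint_left]; intro i hi hj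
      simp only [Set.mem_ofPred_eq] at hi hj
      exact lt_asymm hi hj)]
    rw [← Nat.card_coe_set_eq]
    refine Nat.card_congr (Equiv.subtypeEquivRight fun i => ?_)
    simp only [Set.mem_union, Set.mem_ofPred_eq]
    exact ne_comm.trans lt_or_lt_iff_ne.symm
  · rw [sign_prod_eq_neg_one_pow _ fun i => i.2, h2, ← Set.ncard_coe_finset]
    congr 1
    rw [← Set.ncard_image_of_injective _ Subtype.val_injective]
    congr 1
    ext i
    simp only [Finset.coe_filter, Finset.mem_univ, true_and, Set.mem_image, Set.mem_ofPred_eq]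
    exact ⟨by rintro ⟨j, hj, rfl⟩; exact hj, fun h => ⟨⟨i, h.ne⟩, h, rfl⟩⟩

theorem sum_eq_sum_subtype_of_eq_zero {ι M : Type*} [Fintype ι] [AddCommMonoid M] (p : ι → Prop)
    [DecidablePred p] {F : ι → M} (hF : ∀ i, ¬ p i → F i = 0) : ∑ i, F i = ∑ i : {i // p i}, F i := by
  rw [← Fintype.sum_subtype_add_sum_subtype p F, Fintype.sum_eq_zero _ fun i : {i // ¬ p i} =>
    hF i i.2, add_zero]

/-! ### Independence of $\epsilon$ from the adapted bases. -/

section Adapted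

variable {V : Type*} [AddCommGroup V] [Module ℝ V] {ω : LinearMap.BilinForm ℝ V}
  {lam₁ lam₂ : Submodule ℝ V} {n : ℕ}

/-- The first $\dim\kappa$ vectors of `a` lie in $\kappa$ and are independent, so they span
$\kappa$. -/
theorem repr_eq_zero_of_mem_inf {a : Basis (Fin n) ℝ lam₁}
    (ha : ∀ i : Fin n, (i : ℕ) < finrank ℝ ↥(lam₁ ⊓ lam₂) → (a i : V) ∈ lam₂)
    {x : lam₁} (hx : (x : V) ∈ lam₂) {i : Fin n} (hi : finrank ℝ ↥(lam₁ ⊓ lam₂) ≤ i) :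
    a.repr x i = 0 := by
  have : FiniteDimensional ℝ lam₁ := a.finiteDimensional_of_finite
  set d := finrank ℝ ↥(lam₁ ⊓ lam₂) with hd
  let N : Submodule ℝ lam₁ := lam₂.comap lam₁.subtype
  have hN : finrank ℝ N = d := by
    rw [hd, ← Submodule.map_comap_subtype]
    exact (LinearEquiv.finrank_eq (Submodule.equivSubtypeMap lam₁ N))
  have hle : Submodule.span ℝ (a '' {i | (i : ℕ) < d}) ≤ N := by
    rw [Submodule.span_le]
    rintro _ ⟨j, hj, rfl⟩
    exact ha j hj
  have hdn : d ≤ n := by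
    have := Submodule.finrank_le N
    rwa [hN, finrank_eq_card_basis a, Fintype.card_fin] at this
  have hfin : finrank ℝ (Submodule.span ℝ (a '' {i | (i : ℕ) < d})) = d := by
    rw [Set.image_eq_range]
    refine (finrank_span_eq_card (a.linearIndependent.comp _
      (Subtype.val_injective (p := fun i : Fin n => (i : ℕ) < d)))).trans ?_
    simp [Fintype.card_subtype, Fin.card_filter_val_lt, hdn]
  have heq := Submodule.eq_of_le_of_finrank_eq hle (hfin.trans hN.symm)
  have hx' : x ∈ Submodule.span ℝ (a '' {i | (i : ℕ) < d}) := by rw [heq]; exact hx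
  rw [a.mem_span_image] at hx'
  by_contra hne
  have h3 := hx' (Finsupp.mem_support_iff.2 hne)
  simp only [Set.mem_ofPred_eq] at h3
  omega

variable {a a' : Basis (Fin n) ℝ lam₁} {b b' : Basis (Fin n) ℝ lam₂}

theorem IsAdapted.toMatrix_left_eq_zero (h : IsAdapted a b) (h' : IsAdapted a' b') (i : Fin n)
    (hi : finrank ℝ ↥(lam₁ ⊓ lam₂) ≤ i) (j : Fin n) (hj : ¬ finrank ℝ ↥(lam₁ ⊓ lam₂) ≤ j) :
    a.toMatrix a' i j = 0 :=
  repr_eq_zero_of_mem_inf (fun k hk => h k hk ▸ (b k).2)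
    (h' j (not_le.1 hj) ▸ (b' j).2) hi

theorem IsAdapted.toMatrix_right_eq_zero (h : IsAdapted a b) (h' : IsAdapted a' b') (i : Fin n)
    (hi : finrank ℝ ↥(lam₁ ⊓ lam₂) ≤ i) (j : Fin n) (hj : ¬ finrank ℝ ↥(lam₁ ⊓ lam₂) ≤ j) :
    b.toMatrix b' i j = 0 := by
  refine repr_eq_zero_of_mem_inf (lam₂ := lam₁) (fun k hk => ?_) ?_ ?_
  · rw [inf_comm] at hk
    exact h k hk ▸ (a k).2
  · exact h' j (not_le.1 hj) ▸ (a' j).2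
  · rwa [inf_comm]

theorem IsAdapted.toMatrix_eq (h : IsAdapted a b) (h' : IsAdapted a' b') (i j : Fin n)
    (hj : ¬ finrank ℝ ↥(lam₁ ⊓ lam₂) ≤ j) : a.toMatrix a' i j = b.toMatrix b' i j := by
  have h1 : a' j = ∑ k, b.toMatrix b' k j • a k := by
    apply Subtype.ext
    rw [h' j (not_le.1 hj), ← b.sum_toMatrix_smul_self b' j]
    simp only [Submodule.coe_sum, Submodule.coe_smul]
    refine Finset.sum_congr rfl fun k _ => ?_
    by_cases hk : finrank ℝ ↥(lam₁ ⊓ lam₂) ≤ k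
    · rw [h.toMatrix_right_eq_zero h' k hk j hj, zero_smul, zero_smul]
    · rw [h k (not_le.1 hk)]
  rw [Basis.toMatrix_apply, h1, Basis.repr_sum_self]

theorem IsAdapted.apply_eq_zero (h : IsAdapted a b) (h₁ : ∀ x ∈ lam₁, ∀ y ∈ lam₁, ω x y = 0)
    (h₂ : ∀ x ∈ lam₂, ∀ y ∈ lam₂, ω x y = 0) (k l : Fin n)
    (hkl : ¬ finrank ℝ ↥(lam₁ ⊓ lam₂) ≤ k ∨ ¬ finrank ℝ ↥(lam₁ ⊓ lam₂) ≤ l) :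
    ω (a k : V) (b l : V) = 0 := by
  rcases hkl with hk | hl
  · rw [h k (not_le.1 hk)]
    exact h₂ _ (b k).2 _ (b l).2
  · rw [← h l (not_le.1 hl)]
    exact h₁ _ (a k).2 _ (a l).2

/-- A vector of $\kappa$ pairs to zero with both subspaces, so only the quotient blocks of the
transition matrices survive. -/
theorem IsAdapted.quotientPairing_eq (h : IsAdapted a b)
    (h₁ : ∀ x ∈ lam₁, ∀ y ∈ lam₁, ω x y = 0) (h₂ : ∀ x ∈ lam₂, ∀ y ∈ lam₂, ω x y = 0) :
    quotientPairing ω a' b' =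
      ((a.toMatrix a').toSquareBlockProp fun i => finrank ℝ ↥(lam₁ ⊓ lam₂) ≤ i)ᵀ *
        quotientPairing ω a b *
      (b.toMatrix b').toSquareBlockProp fun i => finrank ℝ ↥(lam₁ ⊓ lam₂) ≤ i := by
  ext i j
  have ha := congrArg (lam₁.subtype) (a.sum_toMatrix_smul_self a' i)
  have hb := congrArg (lam₂.subtype) (b.sum_toMatrix_smul_self b' j)
  simp only [map_sum, map_smul, Submodule.subtype_apply] at ha hb
  simp only [quotientPairing, of_apply, mul_apply, transpose_apply, toSquareBlockProp_def]
  rw [← ha, ← hb]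
  simp only [map_sum, map_smul, LinearMap.sum_apply, LinearMap.smul_apply, smul_eq_mul]
  rw [sum_eq_sum_subtype_of_eq_zero (fun l : Fin n => finrank ℝ ↥(lam₁ ⊓ lam₂) ≤ l) fun l hl => by
    simp [h.apply_eq_zero h₁ h₂ _ l (Or.inr hl)]]
  refine Finset.sum_congr rfl fun l _ => ?_
  rw [sum_eq_sum_subtype_of_eq_zero (fun k : Fin n => finrank ℝ ↥(lam₁ ⊓ lam₂) ≤ k) fun k hk => by
    simp [h.apply_eq_zero h₁ h₂ k l (Or.inl hk)], Finset.sum_mul, Finset.mul_sum]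
  exact Finset.sum_congr rfl fun k _ => by ring

theorem sign_mul_self_eq_one {x : ℝ} (hx : x ≠ 0) :
    (SignType.sign x : ℤ) * (SignType.sign x : ℤ) = 1 := by
  rcases lt_or_gt_of_ne hx with h | h
  · simp [sign_neg h]
  · simp [sign_pos h]

/-- Both transition matrices are block triangular with the same block on $\kappa$. The sign `r` of
that block enters twice and cancels; the signs `p`, `q` of the quotient blocks cancel against the
change of the pairing. -/
theorem IsAdapted.sign_eq (h : IsAdapted a b) (h' : IsAdapted a' b')
    (h₁ : ∀ x ∈ lam₁, ∀ y ∈ lam₁, ω x y = 0) (h₂ : ∀ x ∈ lam₂, ∀ y ∈ lam₂, ω x y = 0)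
    (o₁ : Orientation ℝ lam₁ (Fin n)) (o₂ : Orientation ℝ lam₂ (Fin n)) :
    basisSign o₁ a' * basisSign o₂ b' * (SignType.sign (quotientPairing ω a' b').det : ℤ) =
      basisSign o₁ a * basisSign o₂ b * (SignType.sign (quotientPairing ω a b).det : ℤ) := by
  have hP := twoBlockTriangular_det' (a.toMatrix a') _ (h.toMatrix_left_eq_zero h')
  have hQ := twoBlockTriangular_det' (b.toMatrix b') _ (h.toMatrix_right_eq_zero h')
  have hPQ : (b.toMatrix b').toSquareBlockProp (fun i => ¬ finrank ℝ ↥(lam₁ ⊓ lam₂) ≤ i) =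
      (a.toMatrix a').toSquareBlockProp (fun i => ¬ finrank ℝ ↥(lam₁ ⊓ lam₂) ≤ i) := by
    ext i j
    exact (h.toMatrix_eq h' i j j.2).symm
  rw [hPQ] at hQ
  have hP0 : (a.toMatrix a').det ≠ 0 := by
    rw [← Basis.det_apply]; exact (a.isUnit_det a').ne_zero
  have hQ0 : (b.toMatrix b').det ≠ 0 := by
    rw [← Basis.det_apply]; exact (b.isUnit_det b').ne_zero
  have e1 := basisSign_mul_basisSign o₁ a a'
  have e2 := basisSign_mul_basisSign o₂ b b'
  have e3 := basisSign_mul_self o₁ a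
  have e4 := basisSign_mul_self o₂ b
  rw [h.quotientPairing_eq h₁ h₂, det_mul, det_mul, det_transpose]
  rw [hP] at e1 hP0
  rw [hQ] at e2 hQ0
  have s1 := sign_mul_self_eq_one (left_ne_zero_of_mul hP0)
  have s2 := sign_mul_self_eq_one (right_ne_zero_of_mul hP0)
  have s3 := sign_mul_self_eq_one (left_ne_zero_of_mul hQ0)
  simp only [sign_mul, SignType.coe_mul] at e1 e2 ⊢
  generalize (SignType.sign (((a.toMatrix a').toSquareBlockProp
    (fun i : Fin n => finrank ℝ ↥(lam₁ ⊓ lam₂) ≤ (i : ℕ))).det) : ℤ) = p at *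
  generalize (SignType.sign (((a.toMatrix a').toSquareBlockProp
    (fun i : Fin n => ¬ finrank ℝ ↥(lam₁ ⊓ lam₂) ≤ (i : ℕ))).det) : ℤ) = r at *
  generalize (SignType.sign (((b.toMatrix b').toSquareBlockProp
    (fun i : Fin n => finrank ℝ ↥(lam₁ ⊓ lam₂) ≤ (i : ℕ))).det) : ℤ) = q at *
  have f1 : basisSign o₁ a' = basisSign o₁ a * (p * r) := by
    rw [← e1, ← mul_assoc, e3, one_mul]
  have f2 : basisSign o₂ b' = basisSign o₂ b * (q * r) := by
    rw [← e2, ← mul_assoc, e4, one_mul]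
  rw [f1, f2]
  generalize (SignType.sign (quotientPairing ω a b).det : ℤ) = t
  calc _ = basisSign o₁ a * basisSign o₂ b * t * (p * p) * (q * q) * (r * r) := by ring
    _ = _ := by rw [s1, s2, s3]; ring

/-- A left null vector would give an element of `lam₁` orthogonal to `lam₂`, hence in $\kappa$,
whose coordinates outside $\kappa$ vanish. -/
theorem IsAdapted.det_quotientPairing_ne_zero (h : IsAdapted a b)
    (h₁ : ∀ x ∈ lam₁, ∀ y ∈ lam₁, ω x y = 0) (h₂ : ∀ x, (∀ y ∈ lam₂, ω x y = 0) → x ∈ lam₂) :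
    (quotientPairing ω a b).det ≠ 0 := by
  intro h0
  obtain ⟨v, hv0, hv⟩ := exists_vecMul_eq_zero_iff.2 h0
  let c : Fin n → ℝ := fun i => if hi : finrank ℝ ↥(lam₁ ⊓ lam₂) ≤ i then v ⟨i, hi⟩ else 0
  let x : lam₁ := ∑ i, c i • a i
  have hx : (x : V) ∈ lam₂ := by
    apply h₂
    have : (ω x) ∘ₗ lam₂.subtype = 0 := by
      refine b.ext fun j => ?_
      simp only [LinearMap.comp_apply, Submodule.subtype_apply, LinearMap.zero_apply]
      by_cases hj : finrank ℝ ↥(lam₁ ⊓ lam₂) ≤ j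
      · have := congrFun hv ⟨j, hj⟩
        simp only [vecMul, dotProduct, quotientPairing, of_apply, Pi.zero_apply] at this
        rw [← this]
        simp only [x, Submodule.coe_sum, Submodule.coe_smul, map_sum, map_smul,
          LinearMap.sum_apply, LinearMap.smul_apply, smul_eq_mul]
        rw [sum_eq_sum_subtype_of_eq_zero (fun l : Fin n => finrank ℝ ↥(lam₁ ⊓ lam₂) ≤ l)
          fun l hl => by simp [c, hl]]
        exact Finset.sum_congr rfl fun l _ => by simp only [c, l.2, dif_pos]
      · rw [← h j (not_le.1 hj)]
        exact h₁ _ x.2 _ (a j).2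
    intro y hy
    exact LinearMap.congr_fun this ⟨y, hy⟩
  apply hv0
  funext i
  have := repr_eq_zero_of_mem_inf (fun k hk => h k hk ▸ (b k).2) hx i.2
  rw [Basis.repr_sum_self] at this
  simp only [c, i.2, dif_pos] at this
  exact this

theorem basisSign_eq_or {M : Type*} [AddCommGroup M] [Module ℝ M] {n : ℕ}
    (o : Orientation ℝ M (Fin n)) (b : Basis (Fin n) ℝ M) :
    basisSign o b = 1 ∨ basisSign o b = -1 := by
  unfold basisSign
  split_ifs <;> simp

theorem IsAdapted.epsilon_eq (h : IsAdapted a b) (h₁ : ∀ x ∈ lam₁, ∀ y ∈ lam₁, ω x y = 0)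
    (h₂ : ∀ x ∈ lam₂, ∀ y ∈ lam₂, ω x y = 0) (h₃ : ∀ x, (∀ y ∈ lam₂, ω x y = 0) → x ∈ lam₂)
    (o₁ : Orientation ℝ lam₁ (Fin n)) (o₂ : Orientation ℝ lam₂ (Fin n)) :
    epsilon ω o₁ o₂ =
      basisSign o₁ a * basisSign o₂ b * (SignType.sign (quotientPairing ω a b).det : ℤ) := by
  unfold epsilon
  split_ifs with hex
  · obtain ⟨a', b', h', e⟩ := hex
    rw [← h.sign_eq h' h₁ h₂ o₁ o₂, e]
  · have hne : ¬ basisSign o₁ a * basisSign o₂ b *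
        (SignType.sign (quotientPairing ω a b).det : ℤ) = 1 := fun e => hex ⟨a, b, h, e⟩
    have hs : (SignType.sign (quotientPairing ω a b).det : ℤ) = 1 ∨
        (SignType.sign (quotientPairing ω a b).det : ℤ) = -1 :=
      mul_self_eq_one_iff.1 (sign_mul_self_eq_one (h.det_quotientPairing_ne_zero h₁ h₃))
    rcases basisSign_eq_or o₁ a with e1 | e1 <;> rcases basisSign_eq_or o₂ b with e2 | e2 <;>
      rcases hs with e3 | e3 <;> simp_all

end Adapted

/-! ### The form $\star_f$, its radical on a Lagrangian, and dimension counts. -/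

section Isometry

variable {V : Type*} [AddCommGroup V] [Module ℝ V] {ω : LinearMap.BilinForm ℝ V}
  {lam : Submodule ℝ V}

theorem starForm_rangeRestrict_apply {f : V →ₗ[ℝ] V} (hf : ∀ x y, ω (f x) (f y) = ω x y) (x : V)
    (b : im f) : starForm ω f ((f - 1).rangeRestrict x) b = ω x b :=
  starForm_apply hf _ b x rfl

theorem coe_rangeRestrict_sub_one (f : V →ₗ[ℝ] V) (x : V) :
    ((f - 1).rangeRestrict x : V) = f x - x := rfl

/-- The antisymmetric defect of $\star_f$ is $\omega$ itself, so $\star_f$ becomes symmetric on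
isotropic subspaces. -/
theorem starForm_swap {f : V →ₗ[ℝ] V} (hω : ω.IsAlt) (hf : ∀ x y, ω (f x) (f y) = ω x y)
    (a b : im f) : starForm ω f b a = starForm ω f a b + ω a b := by
  obtain ⟨x, rfl⟩ := (f - 1).surjective_rangeRestrict a
  obtain ⟨y, rfl⟩ := (f - 1).surjective_rangeRestrict b
  rw [starForm_rangeRestrict_apply hf, starForm_rangeRestrict_apply hf]
  simp only [coe_rangeRestrict_sub_one, map_sub, LinearMap.sub_apply]
  rw [hf, ← hω.neg_eq y (f x), ← hω.neg_eq y x]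
  ring

variable {f : V ≃ₗ[ℝ] V}

theorem starForm_nondegenerate [FiniteDimensional ℝ V] (hω : ω.Nondegenerate)
    (hf : ∀ x y, ω (f x) (f y) = ω x y) : (starForm ω (f : V →ₗ[ℝ] V)).Nondegenerate := by
  apply LinearMap.BilinForm.Nondegenerate.ofSeparatingLeft
  intro a ha
  obtain ⟨x, rfl⟩ := LinearMap.surjective_rangeRestrict _ a
  have h : f x - x = 0 := by
    apply hω.1
    intro z
    obtain ⟨z, rfl⟩ := f.surjective z
    have := ha (LinearMap.rangeRestrict _ z)
    rw [starForm_rangeRestrict_apply hf] at this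
    simp only [coe_rangeRestrict_sub_one, map_sub, LinearEquiv.coe_coe] at this
    rw [map_sub, LinearMap.sub_apply, hf]
    linarith
  apply Subtype.ext
  simpa using h

/-- A subspace equal to its own orthogonal. -/
def IsLagrangian (ω : LinearMap.BilinForm ℝ V) (lam : Submodule ℝ V) : Prop :=
  ∀ x, x ∈ lam ↔ ∀ y ∈ lam, ω x y = 0

theorem IsLagrangian.apply_eq_zero (h : IsLagrangian ω lam) {x y : V} (hx : x ∈ lam)
    (hy : y ∈ lam) : ω x y = 0 :=
  (h x).1 hx y hy

theorem IsLagrangian.map (h : IsLagrangian ω lam) (hf : ∀ x y, ω (f x) (f y) = ω x y) :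
    IsLagrangian ω (lam.map (f : V →ₗ[ℝ] V)) := by
  intro x
  obtain ⟨x, rfl⟩ := f.surjective x
  have h1 : f x ∈ lam.map (f : V →ₗ[ℝ] V) ↔ x ∈ lam := by simp
  rw [h1, h x]
  constructor
  · rintro hx _ ⟨y, hy, rfl⟩
    exact (hf x y).trans (hx y hy)
  · exact fun hx y hy => (hf x y).symm.trans (hx _ ⟨y, hy, rfl⟩)

theorem IsLagrangian.orthogonal_eq (h : IsLagrangian ω lam) (hω : ω.IsAlt) :
    ω.orthogonal lam = lam := by
  ext x
  rw [LinearMap.BilinForm.mem_orthogonal_iff, h x]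
  exact forall₂_congr fun y _ => hω.eq_iff

theorem orthogonal_im (hω : ω.IsAlt) (hω' : ω.Nondegenerate)
    (hf : ∀ x y, ω (f x) (f y) = ω x y) :
    ω.orthogonal (im (f : V →ₗ[ℝ] V)) = LinearMap.ker ((f : V →ₗ[ℝ] V) - 1) := by
  ext x
  rw [LinearMap.BilinForm.mem_orthogonal_iff, LinearMap.mem_ker]
  constructor
  · intro hx
    apply hω'.1
    intro z
    obtain ⟨z, rfl⟩ := f.surjective z
    have := hω.eq_iff.1 (hx _ ⟨z, rfl⟩)
    simp only [LinearMap.sub_apply, Module.End.one_apply, map_sub,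
      LinearEquiv.coe_coe] at this ⊢
    rw [hf]
    linarith
  · rintro hx _ ⟨z, rfl⟩
    simp only [LinearMap.sub_apply, Module.End.one_apply, LinearEquiv.coe_coe] at hx
    have h1 := hf z x
    rw [sub_eq_zero.1 hx] at h1
    simp only [LinearMap.sub_apply, Module.End.one_apply, map_sub,
      LinearEquiv.coe_coe]
    linarith

theorem finrank_comap_subtype (N L : Submodule ℝ V) :
    finrank ℝ (L.comap N.subtype) = finrank ℝ ↥(N ⊓ L) := by
  rw [← Submodule.map_comap_subtype]
  exact LinearEquiv.finrank_eq (Submodule.equivSubtypeMap N _)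

theorem finrank_inf_comap :
    finrank ℝ ↥(lam ⊓ lam.comap (f : V →ₗ[ℝ] V)) =
      finrank ℝ ↥(lam ⊓ lam.map (f : V →ₗ[ℝ] V)) := by
  have h : (lam ⊓ lam.comap (f : V →ₗ[ℝ] V)).map (f : V →ₗ[ℝ] V) =
      lam ⊓ lam.map (f : V →ₗ[ℝ] V) := by
    ext v
    obtain ⟨v, rfl⟩ := f.surjective v
    simp [and_comm]
  rw [← h]
  exact (LinearEquiv.finrank_map_eq f _).symm

variable [FiniteDimensional ℝ V]

theorem orthogonal_inf_im (hω : ω.IsAlt) (hω' : ω.Nondegenerate)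
    (hf : ∀ x y, ω (f x) (f y) = ω x y) (h : IsLagrangian ω lam) :
    ω.orthogonal (lam ⊓ im (f : V →ₗ[ℝ] V)) = lam ⊔ LinearMap.ker ((f : V →ₗ[ℝ] V) - 1) := by
  rw [← LinearMap.BilinForm.orthogonal_orthogonal hω' hω.isRefl (lam ⊔ _)]
  congr 1
  have h1 : im (f : V →ₗ[ℝ] V) = ω.orthogonal (LinearMap.ker ((f : V →ₗ[ℝ] V) - 1)) := by
    rw [← orthogonal_im hω hω' hf, LinearMap.BilinForm.orthogonal_orthogonal hω' hω.isRefl]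
  apply le_antisymm
  · rw [h1]
    nth_rw 1 [← h.orthogonal_eq hω]
    rintro x ⟨hx1, hx2⟩ y hy
    obtain ⟨u, hu, v, hv, rfl⟩ := Submodule.mem_sup.1 hy
    rw [map_add, LinearMap.add_apply,
      show ω u x = 0 from hx1 u hu, show ω v x = 0 from hx2 v hv, add_zero]
  · rw [le_inf_iff]
    constructor
    · nth_rw 2 [← h.orthogonal_eq hω]
      exact LinearMap.BilinForm.orthogonal_le le_sup_left
    · rw [h1]
      exact LinearMap.BilinForm.orthogonal_le le_sup_right

theorem finrank_star_domain (hω : ω.IsAlt) (hω' : ω.Nondegenerate)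
    (hf : ∀ x y, ω (f x) (f y) = ω x y) (h : IsLagrangian ω lam) :
    finrank ℝ (lam.comap (im (f : V →ₗ[ℝ] V)).subtype)
      + finrank ℝ (LinearMap.ker ((f : V →ₗ[ℝ] V) - 1)) =
    finrank ℝ lam + finrank ℝ ↥(lam ⊓ LinearMap.ker ((f : V →ₗ[ℝ] V) - 1)) := by
  have h1 := LinearMap.BilinForm.finrank_orthogonal hω' (lam ⊓ im (f : V →ₗ[ℝ] V))
  rw [orthogonal_inf_im hω hω' hf h] at h1
  have h2 := Submodule.finrank_sup_add_finrank_inf_eq lam (LinearMap.ker ((f : V →ₗ[ℝ] V) - 1))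
  have h3 := LinearMap.BilinForm.finrank_orthogonal hω' lam
  rw [h.orthogonal_eq hω] at h3
  have h4 := Submodule.finrank_le (lam ⊓ im (f : V →ₗ[ℝ] V))
  have h5 := Submodule.finrank_le lam
  rw [finrank_comap_subtype, inf_comm]
  omega

theorem map_ker_starFormOn (hω : ω.IsAlt) (hω' : ω.Nondegenerate)
    (hf : ∀ x y, ω (f x) (f y) = ω x y) (h : IsLagrangian ω lam) :
    (LinearMap.ker (starFormOn ω (f : V →ₗ[ℝ] V) lam)).map
      ((im (f : V →ₗ[ℝ] V)).subtype ∘ₗ (lam.comap (im (f : V →ₗ[ℝ] V)).subtype).subtype) =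
    (lam ⊓ lam.comap (f : V →ₗ[ℝ] V)).map ((f : V →ₗ[ℝ] V) - 1) := by
  ext v
  constructor
  · rintro ⟨⟨⟨_, x, rfl⟩, hx⟩, ha, rfl⟩
    replace hx : ((f : V →ₗ[ℝ] V) - 1) x ∈ lam := hx
    -- Radical membership says that $x$ is orthogonal to $\lambda\cap(f-1)V$. Removing the component
    -- in $\ker(f-1)$ then gives a preimage in $\lambda$, and its image under $f$ is also in
    -- $\lambda$.
    have hx' : x ∈ lam ⊔ LinearMap.ker ((f : V →ₗ[ℝ] V) - 1) := by
      rw [← orthogonal_inf_im hω hω' hf h]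
      rintro b ⟨hb1, hb2⟩
      apply hω.eq_iff.1
      have := LinearMap.congr_fun ha ⟨⟨b, hb2⟩, hb1⟩
      exact (starForm_rangeRestrict_apply hf x ⟨b, hb2⟩).symm.trans this
    obtain ⟨u, hu, k, hk, rfl⟩ := Submodule.mem_sup.1 hx'
    rw [map_add, LinearMap.mem_ker.1 hk, add_zero] at hx
    refine ⟨u, ⟨hu, ?_⟩, ?_⟩
    · simpa using lam.add_mem hx hu
    · simp only [LinearMap.comp_apply, Submodule.subtype_apply]
      rw [map_add, LinearMap.mem_ker.1 hk, add_zero]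
  · rintro ⟨x, ⟨hx, hfx⟩, rfl⟩
    refine ⟨⟨⟨_, x, rfl⟩, lam.sub_mem hfx hx⟩, ?_, rfl⟩
    rw [SetLike.mem_coe, LinearMap.mem_ker]
    ext ⟨b, hb⟩
    exact (starForm_rangeRestrict_apply hf x b).trans (h.apply_eq_zero hx hb)

theorem finrank_ker_starFormOn (hω : ω.IsAlt) (hω' : ω.Nondegenerate)
    (hf : ∀ x y, ω (f x) (f y) = ω x y) (h : IsLagrangian ω lam) :
    finrank ℝ (LinearMap.ker (starFormOn ω (f : V →ₗ[ℝ] V) lam))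
      + finrank ℝ ↥(lam ⊓ LinearMap.ker ((f : V →ₗ[ℝ] V) - 1)) =
    finrank ℝ ↥(lam ⊓ lam.map (f : V →ₗ[ℝ] V)) := by
  rw [← finrank_inf_comap]
  set P := lam ⊓ lam.comap (f : V →ₗ[ℝ] V) with hP
  have h1 := LinearMap.finrank_range_add_finrank_ker (((f : V →ₗ[ℝ] V) - 1).domRestrict P)
  rw [LinearMap.range_domRestrict, LinearMap.ker_domRestrict, hP,
    ← map_ker_starFormOn hω hω' hf h, finrank_comap_subtype] at h1
  have h2 : P ⊓ LinearMap.ker ((f : V →ₗ[ℝ] V) - 1) =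
      lam ⊓ LinearMap.ker ((f : V →ₗ[ℝ] V) - 1) := by
    refine le_antisymm (inf_le_inf_right _ inf_le_left) fun v hv => ⟨⟨hv.1, ?_⟩, hv.2⟩
    have hfv : f v = v := sub_eq_zero.1 hv.2
    simpa [hfv] using hv.1
  rw [← hP, h2] at h1
  rw [← h1]
  congr 1
  exact LinearEquiv.finrank_eq (Submodule.equivMapOfInjective _
    (Subtype.val_injective.comp Subtype.val_injective) _)

/-- Here `y` extends a basis of $\lambda\cap\ker(f-1)$ through $\lambda\cap f^{-1}\lambda$ to
$\lambda$, and `x` extends the image of the middle stage under $f$. The last clause records that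
fixed vectors of $\lambda$ are spanned by the first $m$ basis vectors; it makes the remaining
$(f-1)x_i$ independent. -/
theorem exists_adapted_bases {m ρ e : ℕ}
    (hm : finrank ℝ ↥(lam ⊓ LinearMap.ker ((f : V →ₗ[ℝ] V) - 1)) = m)
    (hρ : finrank ℝ ↥(lam ⊓ lam.map (f : V →ₗ[ℝ] V)) = m + ρ) (he : finrank ℝ lam = m + (ρ + e)) :
    ∃ x y : Basis (Fin m ⊕ (Fin ρ ⊕ Fin e)) ℝ lam,
      (∀ i, f (y (Sum.inl i)) = y (Sum.inl i)) ∧ (∀ i, x (Sum.inl i) = y (Sum.inl i)) ∧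
      (∀ i, (x (Sum.inr (Sum.inl i)) : V) = f (y (Sum.inr (Sum.inl i)))) ∧
      ∀ u : lam, f u = u → ∀ i, x.repr u (Sum.inr i) = 0 := by
  let K := LinearMap.ker ((f : V →ₗ[ℝ] V) - 1)
  let P := lam ⊓ lam.comap (f : V →ₗ[ℝ] V)
  have hK : ∀ v, v ∈ K ↔ f v = v := fun v => by simp [K, sub_eq_zero]
  let bM : Basis (Fin m) ℝ ↥(lam ⊓ K) := finBasisOfFinrankEq ℝ _ hm
  have hfix : ∀ i, f (bM i) = bM i := fun i => (hK _).1 (bM i).2.2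
  have hMP : lam ⊓ K ≤ P := fun v hv => ⟨hv.1, by
    simpa [Submodule.mem_comap, (hK v).1 hv.2] using hv.1⟩
  obtain ⟨yP, hyP⟩ := exists_basis_extending (W := P) (e := ρ)
    (v := fun i => Submodule.inclusion hMP (bM i))
    (bM.linearIndependent.map' _ (Submodule.ker_inclusion _ _ _))
    (by rw [Fintype.card_fin, ← hρ]; exact finrank_inf_comap.symm)
  have hcard : Fintype.card (Fin m ⊕ Fin ρ) + e = finrank ℝ lam := by
    simp only [Fintype.card_sum, Fintype.card_fin]; omega
  obtain ⟨y, hy⟩ := exists_basis_extending (W := lam) (e := e)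
    (v := fun i => Submodule.inclusion inf_le_left (yP i))
    (yP.linearIndependent.map' _ (Submodule.ker_inclusion _ _ _)) hcard
  let fP : P →ₗ[ℝ] lam := ((f : V →ₗ[ℝ] V) ∘ₗ P.subtype).codRestrict lam fun v => v.2.2
  have hfP : ∀ v, (fP v : V) = f v := fun _ => rfl
  obtain ⟨x, hx⟩ := exists_basis_extending (W := lam) (e := e) (v := fun i => fP (yP i))
    (yP.linearIndependent.map' fP (LinearMap.ker_eq_bot.2 fun u v huv =>
      Subtype.ext (f.injective (congrArg Subtype.val huv)))) hcard
  have hx1 : ∀ i, (x (Sum.inl (Sum.inl i)) : V) = bM i := fun i => by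
    rw [hx, ← hfix]
    simp [hfP, hyP]
  have hy1 : ∀ i, (y (Sum.inl (Sum.inl i)) : V) = bM i := fun i => by
    rw [hy]
    simp [hyP]
  refine ⟨x.reindex (Equiv.sumAssoc _ _ _), y.reindex (Equiv.sumAssoc _ _ _), fun i => ?_,
    fun i => ?_, fun i => ?_, fun u hu i => ?_⟩
  · simp [hy1, hfix]
  · apply Subtype.ext
    simp [hy1, hx1]
  · simp [hx, hy, hfP]
  · have hu' : u = ∑ j, bM.repr ⟨u, u.2, (hK _).2 hu⟩ j • x (Sum.inl (Sum.inl j)) := by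
      apply Subtype.ext
      have := congrArg (lam ⊓ K).subtype (bM.sum_repr ⟨u, u.2, (hK _).2 hu⟩)
      simp only [map_sum, map_smul, Submodule.subtype_apply] at this
      simp only [Submodule.coe_sum, Submodule.coe_smul, hx1, this]
    rw [hu']
    rcases i with i | i <;> simp

end Isometry

/-! ### The sign of $\det\star_f$ in adapted bases. -/

section StarDeterminant

variable {V : Type*} [AddCommGroup V] [Module ℝ V] {ω : LinearMap.BilinForm ℝ V}
  {lam : Submodule ℝ V} {f : V ≃ₗ[ℝ] V} [FiniteDimensional ℝ V]

theorem linearIndependent_of_det_gram_ne_zero {M ι : Type*} [AddCommGroup M] [Module ℝ M]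
    [Fintype ι] [DecidableEq ι] {B : LinearMap.BilinForm ℝ M} {v : ι → M}
    (h : (Matrix.of fun i j => B (v i) (v j)).det ≠ 0) : LinearIndependent ℝ v := by
  rw [Fintype.linearIndependent_iff]
  intro c hc
  refine congrFun (Matrix.eq_zero_of_vecMul_eq_zero h ?_)
  ext j
  have := LinearMap.congr_fun (congrArg B hc) (v j)
  simpa [vecMul, dotProduct] using this

theorem det_toMatrix_eq_det_submatrix {M ι κ : Type*} [AddCommGroup M] [Module ℝ M]
    [Fintype ι] [DecidableEq ι] [Fintype κ] [DecidableEq κ] {x y : Basis (ι ⊕ κ) ℝ M}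
    (hxy : ∀ i, x (Sum.inl i) = y (Sum.inl i)) :
    (x.toMatrix y).det = ((x.toMatrix y).submatrix Sum.inr Sum.inr).det := by
  rw [← fromBlocks_toBlocks (x.toMatrix y)]
  have h1 : (x.toMatrix y).toBlocks₁₁ = 1 := by
    ext i j
    simp [toBlocks₁₁, Basis.toMatrix_apply, ← hxy, one_apply, Finsupp.single_apply, eq_comm]
  have h2 : (x.toMatrix y).toBlocks₂₁ = 0 := by
    ext i j
    simp [toBlocks₂₁, Basis.toMatrix_apply, ← hxy]
  rw [h1, h2, det_fromBlocks_zero₂₁, det_one, one_mul]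
  rfl

/-- The basis of $(f-1)V$ consists of $X_i=(f-1)x_i$, vectors $z_j$ dual to the first $\rho$ of the
$X_i$, and the $v_k\in\lambda$ diagonalising the nondegenerate part of $\star_{f,\lambda}$.
Replacing $X$ by $Y=(f-1)y$ in the right-hand slot makes the Gram matrix block-sparse, at the cost
of a factor $\det T$. -/
theorem sgnDetStar_eq (hω : ω.IsAlt) (hω' : ω.Nondegenerate)
    (hf : ∀ x y, ω (f x) (f y) = ω x y) (h : IsLagrangian ω lam) {m ρ e : ℕ}
    {x y : Basis (Fin m ⊕ (Fin ρ ⊕ Fin e)) ℝ lam}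
    (hy : ∀ i, f (y (Sum.inl i)) = y (Sum.inl i)) (hxy : ∀ i, x (Sum.inl i) = y (Sum.inl i))
    (hx : ∀ i, (x (Sum.inr (Sum.inl i)) : V) = f (y (Sum.inr (Sum.inl i))))
    (hfix : ∀ u : lam, f u = u → ∀ i, x.repr u (Sum.inr i) = 0)
    {E : Matrix (Fin e) (Fin e) ℝ}
    (hE : ∀ i j, E i j = ω (x (Sum.inr (Sum.inr i))) (f (y (Sum.inr (Sum.inr j)))))
    (hE0 : E.det ≠ 0) {κ : Type*} [Fintype κ] [DecidableEq κ]
    {v : κ → im (f : V →ₗ[ℝ] V)} {w : κ → ℝ} (hv : ∀ i, (v i : V) ∈ lam)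
    (hvw : ∀ i j, starForm ω (f : V →ₗ[ℝ] V) (v i) (v j) = diagonal w i j) (hw : ∀ i, w i ≠ 0)
    (hcard : finrank ℝ (im (f : V →ₗ[ℝ] V)) = (ρ + e) + (ρ + Fintype.card κ)) :
    sgnDetStar ω (f : V →ₗ[ℝ] V) = (-1) ^ ρ * (SignType.sign E.det : ℤ) *
      (SignType.sign (x.toMatrix y).det : ℤ) * (SignType.sign (∏ i, w i) : ℤ) := by
  let F : V →ₗ[ℝ] V := (f : V →ₗ[ℝ] V)
  let S := starForm ω F
  have hSx : ∀ (u : V) (b : im F), S ((F - 1).rangeRestrict u) b = ω u b :=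
    starForm_rangeRestrict_apply hf
  have hswap : ∀ a b : im F, S b a = S a b + ω a b := starForm_swap hω hf
  have hsub : ∀ u : V, ((F - 1).rangeRestrict u : V) = f u - u := fun _ => rfl
  have hlam : ∀ {a b : V}, a ∈ lam → b ∈ lam → ω a b = 0 := fun ha hb => h.apply_eq_zero ha hb
  let X : Fin ρ ⊕ Fin e → im F := fun i => (F - 1).rangeRestrict (x (Sum.inr i))
  let Y : Fin ρ ⊕ Fin e → im F := fun i => (F - 1).rangeRestrict (y (Sum.inr i))
  have hXind : LinearIndependent ℝ X := by
    rw [Fintype.linearIndependent_iff]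
    intro c hc i
    have h1 := hfix (∑ i, c i • x (Sum.inr i)) (by
      have := congrArg (im F).subtype hc
      simp only [X, map_sum, map_smul, Submodule.subtype_apply, hsub, map_zero, smul_sub,
        Finset.sum_sub_distrib, sub_eq_zero] at this
      simpa using this) i
    rcases i with i | i <;> simpa [Finsupp.single_apply] using h1
  obtain ⟨z, hz⟩ := exists_biorthogonal (starForm_nondegenerate hω' hf)
    (hXind.comp Sum.inl Sum.inl_injective)
  simp only [Function.comp_apply] at hz
  have hXY : ∀ i j, S (X i) (Y j) = ω (x (Sum.inr i)) (f (y (Sum.inr j))) := fun i j => by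
    rw [hSx, hsub, map_sub, hlam (x _).2 (y _).2, sub_zero]
  have hXlam : ∀ i (b : im F), (b : V) ∈ lam → S (X i) b = 0 := fun i b hb => by
    rw [hSx, hlam (x _).2 hb]
  have hYlam : ∀ i : Fin ρ, (Y (Sum.inl i) : V) ∈ lam := fun i => by
    rw [hsub, ← hx]
    exact lam.sub_mem (x _).2 (y _).2
  let l : (Fin ρ ⊕ Fin e) ⊕ (Fin ρ ⊕ κ) → im F := Sum.elim X (Sum.elim z v)
  let r : (Fin ρ ⊕ Fin e) ⊕ (Fin ρ ⊕ κ) → im F := Sum.elim Y (Sum.elim z v)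
  let T : Matrix (Fin ρ ⊕ Fin e) (Fin ρ ⊕ Fin e) ℝ := (x.toMatrix y).submatrix Sum.inr Sum.inr
  have hYT : ∀ j, Y j = ∑ i, T i j • X i := fun j => by
    have h1 := x.sum_toMatrix_smul_self y (Sum.inr j)
    have h2 : ∀ i, (F - 1).rangeRestrict (x (Sum.inl i)) = 0 := fun i => by
      apply Subtype.ext
      rw [hsub, hxy, hy, sub_self]
      rfl
    have h3 := congrArg ((F - 1).rangeRestrict ∘ₗ lam.subtype) h1
    rw [Fintype.sum_sum_type] at h3
    simp only [map_add, map_sum, map_smul, LinearMap.comp_apply, Submodule.subtype_apply, h2,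
      smul_zero, Finset.sum_const_zero, zero_add] at h3
    exact h3.symm
  have hmul : (Matrix.of fun i j => S (l i) (r j)) =
      (Matrix.of fun i j => S (l i) (l j)) * fromBlocks T 0 0 1 := by
    ext i j
    rw [mul_apply, Fintype.sum_sum_type]
    rcases j with j | j
    · simp [l, r, hYT, mul_comm]
    · simp [l, r, one_apply]
  -- The reordering puts the first $\rho$ of the $X$ (or $Y$) next to $z$, forming the hyperbolic
  -- block, and the last $e$ next to $v$. Most zeros come from $\lambda$ being isotropic, since the
  -- first $\rho$ of the $Y_j$ and all $v_k$ lie in $\lambda$.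
  have hblocks : (Matrix.of fun i j => S (l i) (r j)).submatrix
        (Equiv.sumSumSumComm (Fin ρ) (Fin ρ) (Fin e) κ)
        (Equiv.sumSumSumComm (Fin ρ) (Fin ρ) (Fin e) κ) =
      fromBlocks (fromBlocks (0 : Matrix (Fin ρ) (Fin ρ) ℝ) 1 1 (of fun i j => S (z i) (z j)))
        (fromRows (0 : Matrix (Fin ρ) (Fin e ⊕ κ) ℝ)
          (of fun i j => S (z i) (Sum.elim (Y ∘ Sum.inr) v j)))
        (fromCols (0 : Matrix (Fin e ⊕ κ) (Fin ρ) ℝ)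
          (of fun i j => S (Sum.elim (X ∘ Sum.inr) v i) (z j)))
        (fromBlocks E 0 (of fun i j => S (v i) (Y (Sum.inr j))) (diagonal w)) := by
    ext i j
    rcases i with (i | i) | (i | i) <;> rcases j with (j | j) | (j | j)
    · exact hXlam _ _ (hYlam j)
    · exact (hz i j).trans (one_apply).symm
    · refine (hXY _ _).trans ?_
      rw [hx, hf]
      exact hlam (y _).2 (y _).2
    · exact hXlam _ _ (hv j)
    · change S (z i) (Y (Sum.inl j)) = (1 : Matrix _ _ ℝ) i j
      -- Swapping gives $z_i\star
      -- Y_j=\omega(y_j,z_i)+\omega(f(y_j)-y_j,z_i)=\omega(x_j,z_i)=X_j\star z_i$.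
      rw [hswap (Y (Sum.inl j)), hSx, hsub, ← hx, map_sub, LinearMap.sub_apply, add_sub_cancel,
        ← hSx, hz, one_apply]
      simp only [eq_comm]
    · rfl
    · rfl
    · rfl
    · exact hXlam _ _ (hYlam j)
    · rfl
    · exact (hXY _ _).trans (hE i j).symm
    · exact hXlam _ _ (hv j)
    · change S (v i) (Y (Sum.inl j)) = 0
      rw [hswap (Y (Sum.inl j)), hSx, hlam (hYlam j) (hv i), hlam (y _).2 (hv i), add_zero]
    · rfl
    · rfl
    · exact hvw i j
  have hdet := congrArg Matrix.det hblocks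
  rw [det_submatrix_equiv_self, hmul, det_mul, det_fromBlocks_hyperbolic, det_fromBlocks_zero₁₂,
    det_fromBlocks_zero₁₂, det_diagonal, det_one, mul_one, Fintype.card_fin,
    ← det_toMatrix_eq_det_submatrix hxy] at hdet
  have hw0 : ∏ i, w i ≠ 0 := Finset.prod_ne_zero_iff.2 fun i _ => hw i
  have hne : (Matrix.of fun i j => S (l i) (l j)).det * (x.toMatrix y).det ≠ 0 := by
    rw [hdet]
    exact mul_ne_zero (pow_ne_zero _ (by norm_num)) (mul_ne_zero hE0 hw0)
  -- The nonzero Gram determinant also proves independence of `l`, and `hcard` then makes `l` a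
  -- basis.
  have hind := linearIndependent_of_det_gram_ne_zero (left_ne_zero_of_mul hne)
  let bas : Basis ((Fin ρ ⊕ Fin e) ⊕ (Fin ρ ⊕ κ)) ℝ (im F) :=
    basisOfLinearIndependentOfCardEqFinrank' l hind (by
      simp only [Fintype.card_sum, Fintype.card_fin]
      exact hcard.symm)
  have hgram : LinearMap.BilinForm.toMatrix bas S = Matrix.of fun i j => S (l i) (l j) := by
    ext i j
    simp [LinearMap.BilinForm.toMatrix_apply, bas]
  have hT := sign_mul_self_eq_one (right_ne_zero_of_mul hne)
  have hsgn := congrArg (fun t : ℝ => (SignType.sign t : ℤ)) hdet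
  simp only [sign_mul, SignType.coe_mul, sign_pow, SignType.coe_pow] at hsgn
  rw [sgnDetStar, sign_det_toMatrix_eq _ _ bas, hgram]
  generalize (SignType.sign (Matrix.of fun i j => S (l i) (l j)).det : ℤ) = G at *
  generalize (SignType.sign (x.toMatrix y).det : ℤ) = t at *
  have : G = G * t * t := by rw [mul_assoc, hT, mul_one]
  rw [this, hsgn, show SignType.sign (-1 : ℝ) = -1 from sign_neg (by norm_num)]
  simp only [SignType.coe_neg_one]
  ring

end StarDeterminant

/-! ### Evaluation of $\epsilon(\lambda,f\lambda)$ and comparison of the powers of $i$. -/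

section LionVergne

variable {V : Type*} [AddCommGroup V] [Module ℝ V] {ω : LinearMap.BilinForm ℝ V}
  {lam : Submodule ℝ V} {f : V ≃ₗ[ℝ] V}

theorem epsilon_map_eq (hf : ∀ x y, ω (f x) (f y) = ω x y)
    (h : IsLagrangian ω lam) {m ρ e : ℕ} {x y : Basis (Fin m ⊕ (Fin ρ ⊕ Fin e)) ℝ lam}
    (hd : finrank ℝ ↥(lam ⊓ lam.map (f : V →ₗ[ℝ] V)) = m + ρ)
    (hy : ∀ i, f (y (Sum.inl i)) = y (Sum.inl i)) (hxy : ∀ i, x (Sum.inl i) = y (Sum.inl i))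
    (hx : ∀ i, (x (Sum.inr (Sum.inl i)) : V) = f (y (Sum.inr (Sum.inl i))))
    {E : Matrix (Fin e) (Fin e) ℝ}
    (hE : ∀ i j, E i j = ω (x (Sum.inr (Sum.inr i))) (f (y (Sum.inr (Sum.inr j)))))
    (o : Orientation ℝ lam (Fin (m + (ρ + e)))) :
    E.det ≠ 0 ∧ epsilon ω o (Orientation.map (Fin (m + (ρ + e))) (f.submoduleMap lam) o) =
      (SignType.sign (x.toMatrix y).det : ℤ) * (SignType.sign E.det : ℤ) := by
  let σ : Fin m ⊕ (Fin ρ ⊕ Fin e) ≃ Fin (m + (ρ + e)) :=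
    (Equiv.sumCongr (Equiv.refl _) finSumFinEquiv).trans finSumFinEquiv
  have hσ₁ : ∀ i, (σ (Sum.inl i) : ℕ) = i := fun i => by simp [σ]
  have hσ₂ : ∀ i, (σ (Sum.inr (Sum.inl i)) : ℕ) = m + i := fun i => by simp [σ]
  have hσ₃ : ∀ i, (σ (Sum.inr (Sum.inr i)) : ℕ) = m + (ρ + i) := fun i => by simp [σ]
  let a := x.reindex σ
  let b := (y.reindex σ).map (f.submoduleMap lam)
  have ha : ∀ i, a (σ i) = x i := fun i => by simp [a]
  have hb : ∀ i, (b (σ i) : V) = f (y i) := fun i => by simp [b]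
  have hab : IsAdapted a b := by
    intro i hi
    rw [hd] at hi
    obtain ⟨i, rfl⟩ := σ.surjective i
    rw [ha, hb]
    rcases i with i | i | i
    · rw [hy, hxy]
    · rw [hx]
    · rw [hσ₃] at hi
      omega
  let q : Fin e → {i : Fin (m + (ρ + e)) // finrank ℝ ↥(lam ⊓ lam.map (f : V →ₗ[ℝ] V)) ≤ i} :=
    fun k => ⟨σ (Sum.inr (Sum.inr k)), by rw [hd, hσ₃]; omega⟩
  have hq : Function.Bijective q := by
    constructor
    · intro k l hkl
      simpa [q] using hkl
    · rintro ⟨i, hi⟩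
      obtain ⟨i, rfl⟩ := σ.surjective i
      rw [hd] at hi
      rcases i with i | i | i
      · rw [hσ₁] at hi; omega
      · rw [hσ₂] at hi; omega
      · exact ⟨i, rfl⟩
  have hEq : E.det = (quotientPairing ω a b).det := by
    rw [← det_submatrix_equiv_self (Equiv.ofBijective q hq)]
    congr 1
    ext i j
    rw [hE, submatrix_apply, quotientPairing, of_apply]
    change _ = ω (a (σ _) : V) (b (σ _) : V)
    rw [ha, hb]
  have hl : ∀ u ∈ lam, ∀ v ∈ lam, ω u v = 0 := fun u hu => (h u).1 hu
  have hl' := h.map hf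
  rw [hEq]
  refine ⟨hab.det_quotientPairing_ne_zero hl fun u => (hl' u).2, ?_⟩
  -- Since $f(\lambda)$ carries the image orientation, $f(y)$ has the sign of $y$, and the two basis
  -- signs combine to the sign of $\det T$.
  rw [hab.epsilon_eq hl (fun u hu => (hl' u).1 hu) fun u => (hl' u).2, basisSign_map,
    basisSign_mul_basisSign]
  congr 3
  have : a.toMatrix (y.reindex σ) = (x.toMatrix y).submatrix σ.symm σ.symm := by
    ext i j
    simp [a, Basis.toMatrix_apply]
  rw [this, det_submatrix_equiv_self]

/-- This is the role of the summand $-\mathrm{sgn}(\det\star_f)+1$ in $n(f)$: the exponent is $0$ or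
$-2$, which turns a sign into a power of $i$. -/
theorem I_zpow_sub_one_of_sign {s : ℤ} (hs : s * s = 1) : Complex.I ^ (s - 1) = (s : ℂ) := by
  rcases mul_self_eq_one_iff.1 hs with rfl | rfl
  · simp
  · norm_num [_root_.zpow_neg]

theorem lagrangianS_map_eq [FiniteDimensional ℝ V] (hω : ω.IsAlt) (hω' : ω.Nondegenerate)
    (hf : ∀ x y, ω (f x) (f y) = ω x y) (h : IsLagrangian ω lam) {n : ℕ}
    (hn : finrank ℝ lam = n) (o : Orientation ℝ lam (Fin n)) :
    lagrangianS ω o (Orientation.map (Fin n) (f.submoduleMap lam) o) =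
      Complex.I ^ (-gmN ω lam (f : V →ₗ[ℝ] V)) := by
  obtain ⟨m, hm⟩ : ∃ m, finrank ℝ ↥(lam ⊓ LinearMap.ker ((f : V →ₗ[ℝ] V) - 1)) = m := ⟨_, rfl⟩
  obtain ⟨ρ, hρ⟩ : ∃ ρ, finrank ℝ (LinearMap.ker (starFormOn ω (f : V →ₗ[ℝ] V) lam)) = ρ :=
    ⟨_, rfl⟩
  have hd := finrank_ker_starFormOn hω hω' hf h
  rw [hm, hρ, add_comm] at hd
  obtain ⟨e, rfl⟩ : ∃ e, n = m + (ρ + e) := by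
    have := Submodule.finrank_mono (inf_le_left : lam ⊓ lam.map (f : V →ₗ[ℝ] V) ≤ lam)
    exact ⟨n - (m + ρ), by omega⟩
  obtain ⟨x, y, hy, hxy, hx, hfix⟩ := exists_adapted_bases hm hd.symm hn
  let E : Matrix (Fin e) (Fin e) ℝ :=
    of fun i j => ω (x (Sum.inr (Sum.inr i))) (f (y (Sum.inr (Sum.inr j))))
  obtain ⟨hE0, hε⟩ := epsilon_map_eq hf h hd.symm hy hxy hx (E := E) (fun _ _ => rfl) o
  have hsymm : ∀ u v, starFormOn ω (f : V →ₗ[ℝ] V) lam u v =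
      starFormOn ω (f : V →ₗ[ℝ] V) lam v u := fun u v => by
    refine (starForm_swap hω hf (v : im (f : V →ₗ[ℝ] V)) u).trans ?_
    exact add_eq_left.2 (h.apply_eq_zero v.2 u.2)
  obtain ⟨v, pos, neg, hv, hsig, hcard, hsign, hdim⟩ := exists_orthogonal_basis_signature hsymm
  rw [hρ] at hdim
  have hdimU : finrank ℝ (im (f : V →ₗ[ℝ] V)) = (ρ + e) + (ρ + (pos + neg)) := by
    have h1 := LinearMap.finrank_range_add_finrank_ker ((f : V →ₗ[ℝ] V) - 1)
    have h2 := finrank_star_domain hω hω' hf h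
    have h3 := LinearMap.BilinForm.finrank_orthogonal hω' lam
    rw [h.orthogonal_eq hω] at h3
    have h4 := Submodule.finrank_le lam
    have h5 : finrank ℝ (im (f : V →ₗ[ℝ] V)) =
      finrank ℝ (LinearMap.range ((f : V →ₗ[ℝ] V) - 1)) := rfl
    omega
  have hstar := sgnDetStar_eq hω hω' hf h hy hxy hx hfix (E := E) (fun _ _ => rfl) hE0
    -- Only the non-isotropic vectors of the diagonalising basis are kept; the radical directions
    -- are already represented by the first $\rho$ of the $Y_j$.
    (κ := {i // starFormOn ω (f : V →ₗ[ℝ] V) lam (v i) (v i) ≠ 0})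
    (v := fun i => v i) (w := fun i => starFormOn ω (f : V →ₗ[ℝ] V) lam (v i) (v i))
    (fun i => (v i).2) (fun i j => by
      by_cases hij : i = j
      · subst hij
        rw [diagonal_apply_eq]
        rfl
      · rw [diagonal_apply_ne _ hij]
        exact hv _ _ fun hij' => hij (Subtype.ext hij'))
    (fun i => i.2) (by rw [hdimU, ← hcard, Nat.card_eq_fintype_card])
  rw [hsign] at hstar
  have hT0 : (x.toMatrix y).det ≠ 0 := by
    rw [← Basis.det_apply]; exact (x.isUnit_det y).ne_zero
  have hst := sign_mul_self_eq_one hT0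
  have hsE := sign_mul_self_eq_one hE0
  have hs1 : ∀ k : ℕ, ((-1 : ℤ) ^ k) * (-1) ^ k = 1 := fun k => by rw [← mul_pow]; simp
  rw [lagrangianS, hε, gmN, sigStarOn, hsig, hdimU, hn, ← hd]
  simp only [SignType.coe_pow, SignType.coe_neg_one] at hstar
  generalize (SignType.sign (x.toMatrix y).det : ℤ) = t at *
  generalize (SignType.sign E.det : ℤ) = s at *
  have hS : sgnDetStar ω (f : V →ₗ[ℝ] V) = (-1) ^ (ρ + neg) * (t * s) := by
    rw [hstar, pow_add]; ring
  have hS1 : sgnDetStar ω (f : V →ₗ[ℝ] V) * sgnDetStar ω (f : V →ₗ[ℝ] V) = 1 := by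
    rw [hS]
    calc _ = ((-1 : ℤ) ^ (ρ + neg) * (-1) ^ (ρ + neg)) * (t * t) * (s * s) := by ring
      _ = 1 := by rw [hs1, hst, hsE]; norm_num
  -- `pos` cancels, while `neg` and `ρ` are doubled. Their factor $(-1)^{\rho+neg}$ then cancels the
  -- one relating $\mathrm{sgn}\det\star_f$ to $\epsilon$.
  have hexp : -((pos : ℤ) - neg - ((ρ + e + (ρ + (pos + neg)) : ℕ) : ℤ)
      - sgnDetStar ω (f : V →ₗ[ℝ] V) + 1) =
      (e : ℤ) + 2 * ((ρ + neg : ℕ) : ℤ) + (sgnDetStar ω (f : V →ₗ[ℝ] V) - 1) := by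
    push_cast; ring
  rw [hexp, zpow_add₀ Complex.I_ne_zero, zpow_add₀ Complex.I_ne_zero, I_zpow_sub_one_of_sign hS1,
    _root_.zpow_mul, hS, show m + (ρ + e) - (m + ρ) = e by omega]
  have hI : Complex.I ^ (2 : ℤ) = -1 := by simp
  rw [hI, zpow_natCast, zpow_natCast]
  push_cast
  have hs2 : ((-1 : ℂ) ^ (ρ + neg)) * (-1) ^ (ρ + neg) = 1 := by rw [← mul_pow]; simp
  rw [mul_assoc, ← mul_assoc ((-1 : ℂ) ^ (ρ + neg)), hs2, one_mul]

end LionVergne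

/-! ### The standard symplectic space and the Lagrangian $\lambda_0$. -/

section Standard

theorem stdForm_isAlt (g : ℕ) : (stdForm g).IsAlt := fun x => by
  rw [stdForm_apply]
  exact Finset.sum_eq_zero fun i _ => by ring

theorem stdForm_single_inl (g : ℕ) (x : Std g) (i : Fin g) :
    stdForm g x (Pi.single (Sum.inl i) 1) = -x (Sum.inr i) := by
  rw [stdForm_apply]
  simp [Pi.single_apply]

theorem stdForm_single_inr (g : ℕ) (x : Std g) (i : Fin g) :
    stdForm g x (Pi.single (Sum.inr i) 1) = x (Sum.inl i) := by
  rw [stdForm_apply]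
  simp [Pi.single_apply]

theorem stdForm_nondegenerate (g : ℕ) : (stdForm g).Nondegenerate := by
  apply LinearMap.BilinForm.Nondegenerate.ofSeparatingLeft
  intro x hx
  ext i
  rcases i with i | i
  · exact (stdForm_single_inr g x i).symm.trans (hx _)
  · exact neg_eq_zero.1 ((stdForm_single_inl g x i).symm.trans (hx _))

theorem mem_lambda0_iff (g : ℕ) (x : Std g) : x ∈ lambda0 g ↔ ∀ i, x (Sum.inr i) = 0 := by
  constructor
  · intro hx i
    induction hx using Submodule.span_induction with
    | mem x h => obtain ⟨j, rfl⟩ := h; simp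
    | zero => rfl
    | add x y _ _ hx hy => simp [hx, hy]
    | smul c x _ hx => simp [hx]
  · intro hx
    have : x = ∑ i, x (Sum.inl i) • (Pi.single (Sum.inl i) 1 : Std g) := by
      ext j
      rcases j with j | j
      · simp [Pi.single_apply]
      · simp [hx]
    rw [this]
    exact Submodule.sum_mem _ fun i _ => Submodule.smul_mem _ _ (Submodule.subset_span ⟨i, rfl⟩)

theorem isLagrangian_lambda0 (g : ℕ) : IsLagrangian (stdForm g) (lambda0 g) := by
  intro x
  constructor
  · intro hx y hy
    rw [mem_lambda0_iff] at hx hy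
    rw [stdForm_apply]
    simp [hx, hy]
  · intro hx
    rw [mem_lambda0_iff]
    intro i
    rw [← neg_eq_zero, ← stdForm_single_inl]
    exact hx _ (Submodule.subset_span ⟨i, rfl⟩)

/-- A subspace equal to its own orthogonal has half the dimension of the space. -/
theorem finrank_lambda0 (g : ℕ) : finrank ℝ (lambda0 g) = g := by
  have h1 := LinearMap.BilinForm.finrank_orthogonal (stdForm_nondegenerate g) (lambda0 g)
  rw [(isLagrangian_lambda0 g).orthogonal_eq (stdForm_isAlt g)] at h1
  have h2 : finrank ℝ (Std g) = g + g := by simp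
  have h3 := Submodule.finrank_le (lambda0 g)
  omega

end Standard

end SympSign

end

theorem mainTheorem5 (g : ℕ)
    (hwtj : ∀ f₁ f₂ : SympSign.Sp g,
      SympSign.sigStarPair f₁ f₂
        - SympSign.maslov (SympSign.stdForm g) (SympSign.lambda0 g)
            (SympSign.image0 f₁) (SympSign.image0 (f₁ * f₂))
        + SympSign.sigStar (f₁ * f₂) - SympSign.sigStar f₁ - SympSign.sigStar f₂ ≡ 0 [ZMOD 4])
    (f : SympSign.Sp g) (o : Orientation ℝ (SympSign.lambda0 g) (Fin g)) :
    SympSign.lionVergneS o f = Complex.I ^ (-SympSign.gilmerMasbaumN f) :=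
  SympSign.lagrangianS_map_eq (SympSign.stdForm_isAlt g) (SympSign.stdForm_nondegenerate g)
    (SympSign.stdForm_act f) (SympSign.isLagrangian_lambda0 g) (SympSign.finrank_lambda0 g) o
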